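/- Let $m\ge 1$ and let $X\subseteq\{0,1\}^m$ be non-degenerate, i.e. for every $j\in[m]=\{1,\dots,m\}$ both values $0$ and $1$ occur as the $j$-th coordinate of some element of $X$. For $n\ge 1$, an IIA aggregator for $X$ of arity $n$ is a map $f:X^n\to X$ for which there are functions $f_1,\dots,f_m:\{0,1\}^n\to\{0,1\}$ (then uniquely determined) such that $f(x^{(1)},\dots,x^{(n)})_j=f_j(x^{(1)}_j,\dots,x^{(n)}_j)$ for all $x^{(1)},\dots,x^{(n)}\in X$ and all $j\in[m]$. It is idempotent if $f(x,\dots,x)=x$ for all $x\in X$, and a dictatorship if there is a $k\in[n]$ with $f(x^{(1)},\dots,x^{(n)})=x^{(k)}$ for all $x^{(1)},\dots,x^{(n)}\in X$. The set $X$ is an impossibility domain (with respect to IIA + Idempotency + Non-dictatorship) if for every $n\ge 2$ every idempotent IIA aggregator for $X$ of arity $n$ is a dictatorship. A minimally infeasible partial evaluation (MIPE) is a map $u:S\to\{0,1\}$ with $S\subseteq[m]$ that is not the restriction of any element of $X$, but such that flipping any single bit of $u$ gives a restriction of some element of $X$. The blockedness graph of $X$ is the directed graph on $[m]\times\{0,1\}$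 with an edge from $(k,\sigma)$ to $(\ell,\rho)$ if and only if $k\ne\ell$ and there is a MIPE $u:S\to\{0,1\}$ with $k,\ell\in S$, $u_k=\sigma$ and $u_\ell=1-\rho$. The set $X$ is totally blocked if this graph is strongly connected. Then: (a) $X$ is an impossibility domain if and only if $X$ is totally blocked and $X$ is not an affine subspace of $\mathbb{F}_2^m$. (b) If $X$ is not totally blocked, then for every $j\in[m]$ at least one of the following holds: 1. there is an idempotent IIA aggregator $f$ of arity $2$ for $X$ such that $f_j(u,v)=u\vee v$ or $f_j(u,v)=u\wedge v$; 2. there is an idempotent IIA aggregator $f$ of arity $3$ for $X$ such that $f_j(u,v,w)=(u\vee v)\wedge(v\vee w)\wedge(w\vee u)$ (majority); 3. there is an idempotent IIA aggregator $f$ of arity $3$ for $X$ such that $f_j(u,v,w)=u-v+w \bmod 2$ (Mal'tsev operation); 4. for every $n\ge1$ and every idempotent IIA aggregator $f$ for $X$ of arity $n$, the component $f_j$ is a projection: there is $k\in[n]$ with $f_j(u_1,\dots,u_n)=u_k$ for all $u\in\{0,1\}^n$. -/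

import Mathlib

namespace Evaluation

variable {m n : ℕ}

/-- The set `D_j = pr_j X` of positions on issue `j` that occur in `X`. -/
def proj (X : Set (Fin m → Bool)) (j : Fin m) : Set Bool :=
  (fun x => x j) '' X

/-- `X` is non-degenerate: `|pr_j X| > 1` for every issue `j`. -/
def NonDegenerate (X : Set (Fin m → Bool)) : Prop :=
  ∀ j, 1 < (proj X j).ncard

/-- The aggregator `f : X^n → X` acts issue by issue through `g = (g_1, …, g_m)`.
For non-degenerate `X` we have `pr_j X = {0,1}`, so `g` is then determined by `f`. -/
def HasComponents {X : Set (Fin m → Bool)} (f : (Fin n → X) → X)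
    (g : Fin m → (Fin n → Bool) → Bool) : Prop :=
  ∀ (x : Fin n → X) (j : Fin m), (f x : Fin m → Bool) j = g j (fun i => (x i : Fin m → Bool) j)

/-- Issue-by-issue aggregation. -/
def IsIIA {X : Set (Fin m → Bool)} (f : (Fin n → X) → X) : Prop :=
  ∃ g : Fin m → (Fin n → Bool) → Bool, HasComponents f g

/-- Idempotency (unanimity). -/
def IsIdempotent {X : Set (Fin m → Bool)} (f : (Fin n → X) → X) : Prop :=
  ∀ x : X, f (fun _ => x) = x

/-- `f` is a dictatorship: some voter always dictates the outcome. -/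
def IsDictatorship {X : Set (Fin m → Bool)} (f : (Fin n → X) → X) : Prop :=
  ∃ k : Fin n, ∀ x : Fin n → X, f x = x k

/-- `X` is a possibility domain for IIA + Idempotency + Non-dictatorship. -/
def PossibilityDomain (X : Set (Fin m → Bool)) : Prop :=
  ∃ n : ℕ, 2 ≤ n ∧ ∃ f : (Fin n → X) → X, IsIIA f ∧ IsIdempotent f ∧ ¬ IsDictatorship f

/-- `X` is an impossibility domain for IIA + Idempotency + Non-dictatorship. -/
def ImpossibilityDomain (X : Set (Fin m → Bool)) : Prop :=
  ¬ PossibilityDomain X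

/-- The partial evaluation `u : S → {0,1}` extends to a full evaluation in `X`. -/
def Feasible (X : Set (Fin m → Bool)) (S : Finset (Fin m)) (u : S → Bool) : Prop :=
  ∃ x ∈ X, ∀ s : S, x s = u s

/-- Minimally infeasible partial evaluation: `u` does not extend to an element of `X`, but
flipping any single bit of `u` gives a partial evaluation that does. -/
def IsMIPE (X : Set (Fin m → Bool)) (S : Finset (Fin m)) (u : S → Bool) : Prop :=
  ¬ Feasible X S u ∧ ∀ s : S, Feasible X S (Function.update u s (!u s))

/-- Directed edges of the blockedness graph on the vertex set `[m] × {0,1}`. -/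
def BlockEdge (X : Set (Fin m → Bool)) (p q : Fin m × Bool) : Prop :=
  p.1 ≠ q.1 ∧ ∃ (S : Finset (Fin m)) (hp : p.1 ∈ S) (hq : q.1 ∈ S) (u : S → Bool),
    u ⟨p.1, hp⟩ = p.2 ∧ u ⟨q.1, hq⟩ = !q.2 ∧ IsMIPE X S u

/-- `X` is totally blocked: the blockedness graph is strongly connected. -/
def TotallyBlocked (X : Set (Fin m → Bool)) : Prop :=
  ∀ p q : Fin m × Bool, Relation.ReflTransGen (BlockEdge X) p q

/-- The identification of `{0,1}` with the two-element field. -/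
def toF2 (b : Bool) : ZMod 2 := if b then 1 else 0

/-- `X` is an affine subspace of `{0,1}^m`, regarded as the vector space `F_2^m`. -/
def IsAffine (X : Set (Fin m → Bool)) : Prop :=
  ∃ A : AffineSubspace (ZMod 2) (Fin m → ZMod 2),
    ∀ x : Fin m → Bool, x ∈ X ↔ (fun j => toF2 (x j)) ∈ A

end Evaluation

namespace Evaluation

/-! ### Idempotent clones on the two-element set -/

/-! For fixed `j`, the `j`-th components of idempotent IIA aggregators form an idempotent Boolean
clone. By `classification` such a clone contains or/and, majority or minority, or has only
projections. This gives (b).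

For (a), call a coalition winning for a vertex `(k, σ)` if it forces the value `σ` on issue `k`
against everyone else. Edges of the blockedness graph preserve winning coalitions
(`BlockEdge.winning`), so if `X` is totally blocked all components coincide and are self-dual. This
excludes or/and; majority would turn edges into implications valid in `X`, hence paths into
contradictions; minority makes `X` affine. Only projections remain.

Conversely, a nonempty proper set of vertices closed under out-edges defines a binary aggregator in
which the first voter alone is winning exactly at these vertices; it is not a dictatorship. An
affine `X` carries minority. -/

/-- A family of Boolean operations that contains the projections, is closed under composition,
and all of whose members are idempotent. -/
structure IsIdempotentClone (P : ∀ n : ℕ, ((Fin n → Bool) → Bool) → Prop) : Prop where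
  proj : ∀ (n : ℕ) (k : Fin n), P n (fun u => u k)
  comp : ∀ (n k : ℕ) (h : (Fin n → Bool) → Bool) (g : Fin n → (Fin k → Bool) → Bool),
    P n h → (∀ i, P k (g i)) → P k (fun u => h (fun i => g i u))
  idem : ∀ (n : ℕ) (h : (Fin n → Bool) → Bool), P n h → ∀ b, h (fun _ => b) = b

namespace IsIdempotentClone

variable {P : ∀ n : ℕ, ((Fin n → Bool) → Bool) → Prop}

lemma minor (hP : IsIdempotentClone P) {n k : ℕ} {h : (Fin n → Bool) → Bool} (hh : P n h)
    (σ : Fin n → Fin k) : P k (fun u => h (fun i => u (σ i))) :=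
  hP.comp n k h (fun i u => u (σ i)) hh (fun i => hP.proj k (σ i))

/-- A clone without conjunction and disjunction consists of self-dual operations. -/
lemma selfDual_of_binary (hP : IsIdempotentClone P)
    (hor : ¬ ∃ h, P 2 h ∧ ∀ u v : Bool, h ![u, v] = (u || v))
    (hand : ¬ ∃ h, P 2 h ∧ ∀ u v : Bool, h ![u, v] = (u && v))
    {n : ℕ} {h : (Fin n → Bool) → Bool} (hh : P n h) (u : Fin n → Bool) :
    h (fun i => !u i) = !h u := by
  -- Identify the arguments of `h` on which `u` agrees: the binary minor takes the values `h u` and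
  -- `h (¬u)` at (1,0) and (0,1). If these were equal, it would be conjunction or disjunction.
  have hg := hP.minor hh (fun i => if u i then (0 : Fin 2) else 1)
  set g : (Fin 2 → Bool) → Bool :=
    fun v => h (fun i => v (if u i then (0 : Fin 2) else 1)) with hgdef
  have h10 : g ![true, false] = h u := by
    simp only [hgdef]; congr 1; funext i; cases u i <;> simp
  have h01 : g ![false, true] = h (fun i => !u i) := by
    simp only [hgdef]; congr 1; funext i; cases u i <;> simp
  have hc : ∀ b, g ![b, b] = b := by
    intro b
    have e : ![b, b] = fun _ => b := by funext i; fin_cases i <;> rfl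
    rw [e, hP.idem 2 g hg b]
  rw [← h10, ← h01]
  cases e1 : g ![true, false] <;> cases e2 : g ![false, true] <;> try rfl
  · exact (hand ⟨g, hg, by intro a b; cases a <;> cases b <;> simp [e1, e2, hc]⟩).elim
  · exact (hor ⟨g, hg, by intro a b; cases a <;> cases b <;> simp [e1, e2, hc]⟩).elim

/-- The majority operation is a composition of any self-dual Pixley operation. -/
lemma majority_of_pixley (hP : IsIdempotentClone P) {g : (Fin 3 → Bool) → Bool} (hg : P 3 g)
    (hdual : ∀ u v w : Bool, g ![!u, !v, !w] = !g ![u, v, w])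
    (h1 : g ![true, false, false] = true) (h2 : g ![false, true, false] = false)
    (h3 : g ![false, false, true] = true) :
    ∃ h, P 3 h ∧ ∀ u v w : Bool, h ![u, v, w] = ((u || v) && (v || w) && (w || u)) := by
  have hidem : ∀ b, g ![b, b, b] = b := by
    intro b
    have e : ![b, b, b] = fun _ => b := by funext i; fin_cases i <;> rfl
    rw [e, hP.idem 3 g hg b]
  have d1 := hdual true false false
  have d2 := hdual false true false
  have d3 := hdual false false true
  simp only [Bool.not_true, Bool.not_false, h1, h2, h3] at d1 d2 d3
  -- The composite is g(u, g(u,v,w), w). For u = w, g returns u whatever its middle argument; for u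
  -- ≠ w, g negates its middle argument, so applying it twice returns v.
  refine ⟨_, hP.comp 3 3 g ![fun u => u 0, g, fun u => u 2] hg ?_, ?_⟩
  · intro i
    fin_cases i
    · exact hP.proj 3 0
    · exact hg
    · exact hP.proj 3 2
  · intro u v w
    have : (fun i => (![fun u => u 0, g, fun u => u 2] : Fin 3 → (Fin 3 → Bool) → Bool) i
        ![u, v, w]) = ![u, g ![u, v, w], w] := by
      funext i; fin_cases i <;> simp
    rw [this]
    cases u <;> cases v <;> cases w <;> simp [h1, h2, h3, d1, d2, d3, hidem]

/-- In a clone of self-dual operations without majority and minority, ternary operations are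
additive on disjoint arguments. -/
lemma ternary_additive (hP : IsIdempotentClone P)
    (hdual : ∀ (g : (Fin 3 → Bool) → Bool), P 3 g →
      ∀ u v w : Bool, g ![!u, !v, !w] = !g ![u, v, w])
    (hmaj : ¬ ∃ h, P 3 h ∧ ∀ u v w : Bool, h ![u, v, w] = ((u || v) && (v || w) && (w || u)))
    (hmin : ¬ ∃ h, P 3 h ∧ ∀ u v w : Bool, h ![u, v, w] = (u ^^ v ^^ w))
    {g : (Fin 3 → Bool) → Bool} (hg : P 3 g) :
    g ![true, true, false] = (g ![true, false, false] || g ![false, true, false]) := by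
  have hidem : ∀ b, g ![b, b, b] = b := by
    intro b
    have e : ![b, b, b] = fun _ => b := by funext i; fin_cases i <;> rfl
    rw [e, hP.idem 3 g hg b]
  have d1 := hdual g hg true false false
  have d2 := hdual g hg false true false
  have d3 := hdual g hg false false true
  simp only [Bool.not_true, Bool.not_false] at d1 d2 d3
  have hperm : ∀ σ : Fin 3 → Fin 3, P 3 (fun u => g ![u (σ 0), u (σ 1), u (σ 2)]) := by
    intro σ
    have := hP.minor hg σ
    convert this using 3 with u
    funext i; fin_cases i <;> rfl
  rw [d3]
  -- A self-dual idempotent ternary operation is determined by its values at the three unit vectors.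
  -- Additivity fails for 000 (majority), 011 and 101 (Pixley, up to a swap) and 111 (minority).
  cases e1 : g ![true, false, false] <;> cases e2 : g ![false, true, false] <;>
    cases e3 : g ![false, false, true] <;> try rfl
  all_goals exfalso
  all_goals simp only [e1, e2, e3, Bool.not_true, Bool.not_false] at d1 d2 d3
  · exact hmaj ⟨g, hg, by
      intro u v w; cases u <;> cases v <;> cases w <;> simp [e1, e2, e3, d1, d2, d3, hidem]⟩
  · exact hmaj (hP.majority_of_pixley (hperm ![1, 0, 2]) (hdual _ (hperm ![1, 0, 2]))
      (by simp [e2]) (by simp [e1]) (by simp [e3]))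
  · exact hmaj (hP.majority_of_pixley hg (hdual _ hg) e1 e2 e3)
  · exact hmin ⟨g, hg, by
      intro u v w; cases u <;> cases v <;> cases w <;> simp [e1, e2, e3, d1, d2, d3, hidem]⟩

/-- An idempotent Boolean clone contains disjunction, conjunction, majority or minority, or
consists of projections only. -/
theorem classification (hP : IsIdempotentClone P) :
    (∃ h, P 2 h ∧ ((∀ u v : Bool, h ![u, v] = (u || v)) ∨ (∀ u v : Bool, h ![u, v] = (u && v)))) ∨
    (∃ h, P 3 h ∧ ∀ u v w : Bool, h ![u, v, w] = ((u || v) && (v || w) && (w || u))) ∨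
    (∃ h, P 3 h ∧ ∀ u v w : Bool, h ![u, v, w] = (u ^^ v ^^ w)) ∨
    (∀ n h, P n h → ∃ k : Fin n, ∀ u, h u = u k) := by
  by_cases hor : ∃ h, P 2 h ∧ ∀ u v : Bool, h ![u, v] = (u || v)
  · obtain ⟨h, hh, e⟩ := hor
    exact Or.inl ⟨h, hh, Or.inl e⟩
  by_cases hand : ∃ h, P 2 h ∧ ∀ u v : Bool, h ![u, v] = (u && v)
  · obtain ⟨h, hh, e⟩ := hand
    exact Or.inl ⟨h, hh, Or.inr e⟩
  by_cases hmaj : ∃ h, P 3 h ∧ ∀ u v w : Bool, h ![u, v, w] = ((u || v) && (v || w) && (w || u))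
  · exact Or.inr (Or.inl hmaj)
  by_cases hmin : ∃ h, P 3 h ∧ ∀ u v w : Bool, h ![u, v, w] = (u ^^ v ^^ w)
  · exact Or.inr (Or.inr (Or.inl hmin))
  refine Or.inr (Or.inr (Or.inr fun n h hh => ?_))
  have hdual3 : ∀ (g : (Fin 3 → Bool) → Bool), P 3 g →
      ∀ u v w : Bool, g ![!u, !v, !w] = !g ![u, v, w] := by
    intro g hg u v w
    rw [← hP.selfDual_of_binary hor hand hg]
    congr 1; funext i; fin_cases i <;> rfl
  have hadd : ∀ a b : Fin n → Bool, (∀ i, (a i && b i) = false) →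
      h (fun i => a i || b i) = (h a || h b) := by
    intro a b hab
    -- Reduce to three arguments: the support of `a`, the support of `b`, and the rest.
    have hg := hP.minor hh (fun i => if a i then (0 : Fin 3) else if b i then 1 else 2)
    have key := hP.ternary_additive hdual3 hmaj hmin hg
    convert key using 2
    · funext i; cases a i <;> cases b i <;> simp
    · congr 1; funext i; cases a i <;> cases b i <;> simp
    · congr 1; funext i
      have := hab i
      revert this; cases a i <;> cases b i <;> simp
  have hsingle : ∀ s : Finset (Fin n), h (fun i => decide (i ∈ s)) = true →
      ∃ k, h (fun i => decide (i = k)) = true := by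
    intro s
    induction s using Finset.induction_on with
    | empty =>
      intro hs
      have := hP.idem n h hh false
      simp [this] at hs
    | insert k s hk ih =>
      intro hs
      have e : (fun i => decide (i ∈ insert k s)) =
          fun i => (decide (i = k) || decide (i ∈ s)) := by
        funext i; simp
      rw [e, hadd _ _ (by intro i; by_cases hi : i = k <;> simp [hi, hk])] at hs
      rcases (Bool.or_eq_true _ _).mp hs with h1 | h1
      · exact ⟨k, h1⟩
      · exact ih h1
  -- The full coalition wins, so by additivity some singleton does; additivity then makes every
  -- coalition containing it win, and self-duality makes it a dictator.
  obtain ⟨k, hk⟩ := hsingle Finset.univ (by simpa using hP.idem n h hh true)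
  have hup : ∀ u : Fin n → Bool, u k = true → h u = true := by
    intro u hu
    have e : u = fun i => (decide (i = k) || (u i && !decide (i = k))) := by
      funext i; by_cases hi : i = k
      · subst hi; simp [hu]
      · simp [hi]
    rw [e, hadd _ _ (by intro i; by_cases hi : i = k <;> simp [hi]), hk, Bool.true_or]
  refine ⟨k, fun u => ?_⟩
  cases hu : u k
  · have := hup (fun i => !u i) (by simp [hu])
    rw [hP.selfDual_of_binary hor hand hh] at this
    simpa using this
  · exact hup u hu

end IsIdempotentClone

/-! ### Components of aggregators -/

variable {m n : ℕ} {X : Set (Fin m → Bool)}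

lemma NonDegenerate.exists_mem (hX : NonDegenerate X) (j : Fin m) (b : Bool) :
    ∃ x : X, (x : Fin m → Bool) j = b := by
  obtain ⟨c, d, ⟨x, hx, hc⟩, ⟨y, hy, hd⟩, hcd⟩ :=
    (Set.one_lt_ncard_iff (Set.toFinite _)).mp (hX j)
  simp only at hc hd
  by_cases h : c = b
  · exact ⟨⟨x, hx⟩, hc.trans h⟩
  · refine ⟨⟨y, hy⟩, hd.trans ?_⟩
    revert h hcd; cases b <;> cases c <;> cases d <;> simp

lemma component_idem (hX : NonDegenerate X) {f : (Fin n → X) → X}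
    {g : Fin m → (Fin n → Bool) → Bool} (hf : HasComponents f g) (hi : IsIdempotent f)
    (j : Fin m) (b : Bool) : g j (fun _ => b) = b := by
  obtain ⟨x, hx⟩ := hX.exists_mem j b
  have := hf (fun _ => x) j
  rw [hi x, hx] at this
  exact this.symm

/-- The `j`-th components of the idempotent issue-by-issue aggregators form a clone. -/
lemma components_isIdempotentClone (hX : NonDegenerate X) (j : Fin m) :
    IsIdempotentClone (fun n h => ∃ (f : (Fin n → X) → X) (g : Fin m → (Fin n → Bool) → Bool),
      HasComponents f g ∧ IsIdempotent f ∧ g j = h) where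
  proj n k := ⟨fun x => x k, fun _ u => u k, fun _ _ => rfl, fun _ => rfl, rfl⟩
  comp n k h g := by
    rintro ⟨F, G, hF, hFi, rfl⟩ hg
    choose f' g' hf' hfi' he using hg
    refine ⟨fun x => F (fun i => f' i x), fun l u => G l (fun i => g' i l u), ?_, ?_, ?_⟩
    · intro x l
      rw [hF]
      congr 1; funext i
      exact hf' i x l
    · intro x
      have : (fun i => f' i (fun _ => x)) = fun _ => x := funext fun i => hfi' i x
      simp only [this]
      exact hFi x
    · simp only [he]
  idem n h := by
    rintro ⟨f, g, hf, hi, rfl⟩ b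
    exact component_idem hX hf hi j b

lemma toF2_xor (u v w : Bool) : toF2 (u ^^ v ^^ w) = toF2 u - toF2 v + toF2 w := by
  revert u v w; decide

/-- A componentwise idempotent operation that preserves `X` is an aggregator. -/
lemma exists_aggregator (G : Fin m → (Fin n → Bool) → Bool)
    (hG : ∀ x : Fin n → X, (fun j => G j (fun i => (x i : Fin m → Bool) j)) ∈ X)
    (hi : ∀ j b, G j (fun _ => b) = b) :
    ∃ f : (Fin n → X) → X, HasComponents f G ∧ IsIdempotent f :=
  ⟨fun x => ⟨_, hG x⟩, fun _ _ => rfl, fun _ => Subtype.ext (funext fun j => hi j _)⟩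

/-! ### Affine domains -/

lemma toF2_injective : Function.Injective toF2 := by
  intro a b; revert a b; decide

lemma IsAffine.possibilityDomain (hm : 1 ≤ m) (hX : NonDegenerate X) (hA : IsAffine X) :
    PossibilityDomain X := by
  obtain ⟨A, hA⟩ := hA
  obtain ⟨f, hf, hi⟩ := exists_aggregator (X := X) (n := 3)
    (fun _ u => (u 0 ^^ u 1 ^^ u 2)) (by
      intro x
      rw [hA]
      have := A.smul_vsub_vadd_mem 1 ((hA _).mp (x 0).2) ((hA _).mp (x 1).2) ((hA _).mp (x 2).2)
      convert this using 1
      funext j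
      exact (toF2_xor _ _ _).trans (by simp)) (by intro _ b; cases b <;> rfl)
  refine ⟨3, by norm_num, f, ⟨_, hf⟩, hi, ?_⟩
  rintro ⟨k, hk⟩
  let j : Fin m := ⟨0, hm⟩
  obtain ⟨a, ha⟩ := hX.exists_mem j true
  obtain ⟨b, hb⟩ := hX.exists_mem j false
  -- Exactly one voter, different from the dictator `k`, holds 1 on issue `j`: minority gives 1, the
  -- dictator 0.
  have h := hf (fun i => if i = k then b else if i = k + 1 then a else b) j
  rw [hk] at h
  fin_cases k <;> simp [ha, hb] at h

/-- A set closed under the coordinatewise minority operation is affine. -/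
lemma isAffine_of_minority {f : (Fin 3 → X) → X} {g : Fin m → (Fin 3 → Bool) → Bool}
    (hf : HasComponents f g) (hg : ∀ j u v w, g j ![u, v, w] = (u ^^ v ^^ w)) : IsAffine X := by
  have hclosed : ∀ x ∈ X, ∀ y ∈ X, ∀ z ∈ X, (fun j => (x j ^^ y j ^^ z j)) ∈ X := by
    intro x hx y hy z hz
    convert (f ![⟨x, hx⟩, ⟨y, hy⟩, ⟨z, hz⟩]).2 using 1
    funext j
    rw [hf, ← hg j]
    congr 1; funext i; fin_cases i <;> rfl
  refine ⟨{ carrier := (fun (x : Fin m → Bool) j => toF2 (x j)) '' X, smul_vsub_vadd_mem' := ?_ }, ?_⟩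
  · rintro c _ _ _ ⟨x, hx, rfl⟩ ⟨y, hy, rfl⟩ ⟨z, hz, rfl⟩
    -- The only scalars are 0 and 1, so closure under x - y + z suffices.
    have hc : c = 0 ∨ c = 1 := by revert c; decide
    rcases hc with rfl | rfl
    · exact ⟨z, hz, by simp⟩
    · exact ⟨_, hclosed x hx y hy z hz, by
        funext j; exact (toF2_xor _ _ _).trans (by simp)⟩
  · intro x
    constructor
    · exact fun hx => ⟨x, hx, rfl⟩
    · rintro ⟨y, hy, e⟩
      have : y = x := funext fun j => toF2_injective (congrFun e j)
      exact this ▸ hy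

/-! ### The blockedness graph -/

/-- Every point outside `X` restricts to a minimally infeasible partial evaluation. -/
lemma exists_isMIPE_of_notMem {y : Fin m → Bool} (hy : y ∉ X) :
    ∃ S : Finset (Fin m), IsMIPE X S (fun s => y s) := by
  classical
  have hne : ((Finset.univ : Finset (Finset (Fin m))).filter
      (fun S => ¬ Feasible X S (fun s => y s))).Nonempty := by
    refine ⟨Finset.univ, Finset.mem_filter.mpr ⟨Finset.mem_univ _, ?_⟩⟩
    rintro ⟨x, hx, e⟩
    exact hy ((funext fun j => e ⟨j, Finset.mem_univ j⟩ : x = y) ▸ hx)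
  obtain ⟨S, hS, hmin⟩ := Finset.exists_min_image _ Finset.card hne
  rw [Finset.mem_filter] at hS
  refine ⟨S, hS.2, fun s => ?_⟩
  have hfe : Feasible X (S.erase s) (fun t => y t) := by
    by_contra hcon
    have := hmin (S.erase s) (Finset.mem_filter.mpr ⟨Finset.mem_univ _, hcon⟩)
    have := Finset.card_erase_lt_of_mem s.2
    omega
  obtain ⟨x, hx, e⟩ := hfe
  refine ⟨x, hx, fun t => ?_⟩
  by_cases hts : t = s
  · subst hts
    rw [Function.update_self]
    by_contra hcon
    refine hS.2 ⟨x, hx, fun r => ?_⟩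
    by_cases hr : r = t
    · subst hr
      revert hcon; cases x r <;> cases y r <;> simp
    · exact e ⟨r, Finset.mem_erase.mpr ⟨fun h => hr (Subtype.ext h), r.2⟩⟩
  · rw [Function.update_of_ne hts]
    exact e ⟨t, Finset.mem_erase.mpr ⟨fun h => hts (Subtype.ext h), t.2⟩⟩

/-- The binary operation attached to membership of the two vertices over an issue in a set of
vertices: `a`, `b` say whether `(k, 0)`, `(k, 1)` belong to the set. -/
def closedSetOp (a b : Bool) (u v : Bool) : Bool :=
  if a then (if b then u else u && v) else (if b then u || v else v)

lemma closedSetOp_self (a b u : Bool) : closedSetOp a b u u = u := by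
  revert a b u; decide

/-- A proper nonempty set of vertices closed under out-edges yields a non-dictatorial aggregator. -/
lemma possibilityDomain_of_not_totallyBlocked (hX : NonDegenerate X) (h : ¬ TotallyBlocked X) :
    PossibilityDomain X := by
  classical
  unfold TotallyBlocked at h
  push Not at h
  obtain ⟨p, q, hpq⟩ := h
  set V : Fin m × Bool → Prop := fun r => Relation.ReflTransGen (BlockEdge X) p r with hV
  have hclosed : ∀ r s, V r → BlockEdge X r s → V s := fun r s hr hrs => hr.tail hrs
  have hp : V p := Relation.ReflTransGen.refl
  set op : Fin m → Bool → Bool → Bool :=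
    fun k => closedSetOp (decide (V (k, false))) (decide (V (k, true))) with hop
  have hout2 : ∀ k a b c, ¬ V (k, c) → op k a b = c → b = c := by
    intro k a b c hc he
    cases c <;> simp only [hop, hc, decide_false] at he <;>
      generalize decide (V _) = t at he <;> revert he <;> revert a b t <;> decide
  have hout1 : ∀ k a b c, V (k, !c) → op k a b = c → a = c := by
    intro k a b c hc he
    cases c <;> simp only [Bool.not_true, Bool.not_false] at hc <;>
      simp only [hop, hc, decide_true] at he <;>
      generalize decide (V _) = t at he <;> revert he <;> revert a b t <;> decide
  have hout : ∀ k a b c, op k a b = c → a = c ∨ b = c := by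
    intro k a b c he
    simp only [hop, closedSetOp] at he
    revert he; cases a <;> cases b <;> cases c <;> split_ifs <;> simp
  obtain ⟨f, hf, hi⟩ := exists_aggregator (X := X) (n := 2) (fun k u => op k (u 0) (u 1)) (by
      intro x
      by_contra hy
      -- The outcome `y` contains a MIPE on `S`; the contradiction sought is that `x 0` or `x 1`
      -- agrees with `y` on all of `S`.
      obtain ⟨S, hS⟩ := exists_isMIPE_of_notMem hy
      set y : Fin m → Bool := fun k => op k ((x 0 : Fin m → Bool) k) ((x 1 : Fin m → Bool) k)
        with hydef
      have hy' : ∀ k, op k ((x 0 : Fin m → Bool) k) ((x 1 : Fin m → Bool) k) = y k := fun _ => rfl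
      have hno : ∀ i : Fin 2, ∃ k ∈ S, (x i : Fin m → Bool) k ≠ y k := by
        intro i
        by_contra! hcon
        exact hS.1 ⟨x i, (x i).2, fun s => hcon s s.2⟩
      have hedge : ∀ k ∈ S, ∀ l ∈ S, k ≠ l → V (k, y k) → V (l, !y l) := by
        intro k hk l hl hkl hVk
        exact hclosed _ _ hVk ⟨hkl, S, hk, hl, fun s => y s, rfl, by simp, hS⟩
      -- If no `(k, y k)` lies in `V`, then `x 1` agrees with `y` on `S`. Otherwise, if `(k, !y k)`
      -- lies in `V` too, `x 0` does; if not, both agree with `y` off `k`, and one of them does at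
      -- `k`.
      obtain ⟨k, hk, hVk⟩ : ∃ k ∈ S, V (k, y k) := by
        by_contra! hcon
        obtain ⟨l, hl, hne⟩ := hno 1
        exact hne (hout2 l _ _ _ (hcon l hl) (hy' l))
      by_cases hk2 : V (k, !y k)
      · obtain ⟨l, hl, hne⟩ := hno 0
        refine hne (hout1 l _ _ _ ?_ (hy' l))
        by_cases hkl : k = l
        · exact hkl ▸ hk2
        · exact hedge k hk l hl hkl hVk
      · have hoth : ∀ l ∈ S, l ≠ k → ¬ V (l, y l) := fun l hl hlk hVl =>
          hk2 (hedge l hl k hk hlk hVl)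
        have h0 : ∀ l ∈ S, l ≠ k → (x 0 : Fin m → Bool) l = y l := fun l hl hlk =>
          hout1 l _ _ _ (hedge k hk l hl (Ne.symm hlk) hVk) (hy' l)
        have h1 : ∀ l ∈ S, l ≠ k → (x 1 : Fin m → Bool) l = y l := fun l hl hlk =>
          hout2 l _ _ _ (hoth l hl hlk) (hy' l)
        rcases hout k _ _ _ (hy' k) with hc | hc
        · obtain ⟨l, hl, hne⟩ := hno 0
          exact hne (if hlk : l = k then hlk ▸ hc else h0 l hl hlk)
        · obtain ⟨l, hl, hne⟩ := hno 1
          exact hne (if hlk : l = k then hlk ▸ hc else h1 l hl hlk))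
    (fun _ _ => closedSetOp_self _ _ _)
  refine ⟨2, le_rfl, f, ⟨_, hf⟩, hi, ?_⟩
  rintro ⟨i, hd⟩
  have hval : ∀ k a b, op k a b = (![a, b] : Fin 2 → Bool) i := by
    intro k a b
    obtain ⟨x, hx⟩ := hX.exists_mem k a
    obtain ⟨y, hy⟩ := hX.exists_mem k b
    have e := hf ![x, y] k
    rw [hd] at e
    simp only [Matrix.cons_val_zero, Matrix.cons_val_one, hx, hy] at e
    rw [← e]
    fin_cases i <;> simp [hx, hy]
  -- The vertex `q` outside `V` rules out the first projection, `p` inside `V` the second.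
  fin_cases i
  · obtain ⟨k, c⟩ := q
    have := hout2 k c (!c) c hpq (hval k c (!c))
    revert this; cases c <;> simp
  · obtain ⟨k, c⟩ := p
    have := hout1 k c (!c) (!c) (by simpa using hp) (hval k c (!c))
    revert this; cases c <;> simp

/-- Along an edge of the blockedness graph, coalitions that are winning for the source are
winning for the target. -/
lemma BlockEdge.winning (hX : NonDegenerate X) {f : (Fin n → X) → X}
    {g : Fin m → (Fin n → Bool) → Bool} (hf : HasComponents f g) (hi : IsIdempotent f)
    {p q : Fin m × Bool} (hpq : BlockEdge X p q) (C : Fin n → Bool)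
    (hC : g p.1 (fun i => if C i then p.2 else !p.2) = p.2) :
    g q.1 (fun i => if C i then q.2 else !q.2) = q.2 := by
  obtain ⟨hne, S, hp, hq, u, hup, huq, hmipe, hflip⟩ := hpq
  obtain ⟨x, hx, ex⟩ := hflip ⟨q.1, hq⟩
  obtain ⟨y, hy, ey⟩ := hflip ⟨p.1, hp⟩
  have exq : x q.1 = q.2 := by simpa [huq] using ex ⟨q.1, hq⟩
  have eyp : y p.1 = !p.2 := by simpa [hup] using ey ⟨p.1, hp⟩
  have ex' : ∀ s : S, s.1 ≠ q.1 → x s = u s := fun s hs => by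
    rw [ex, Function.update_of_ne (fun h => hs (congrArg Subtype.val h))]
  have ey' : ∀ s : S, s.1 ≠ p.1 → y s = u s := fun s hs => by
    rw [ey, Function.update_of_ne (fun h => hs (congrArg Subtype.val h))]
  have exp : x p.1 = p.2 := (ex' ⟨p.1, hp⟩ hne).trans hup
  have eyq : y q.1 = !q.2 := (ey' ⟨q.1, hq⟩ (Ne.symm hne)).trans huq
  -- Members of `C` vote for the extension of `u` flipped at `q`, the others for the one flipped at
  -- `p`. Voters are unanimous on the rest of `S`, so if `C` won at `p` but not at `q`, the outcome
  -- would extend `u`.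
  set z : Fin n → X := fun i => if C i then ⟨x, hx⟩ else ⟨y, hy⟩ with hz
  have hzv : ∀ k, (f z : Fin m → Bool) k = g k (fun i => if C i then x k else y k) := by
    intro k
    rw [hf]
    congr 1; funext i; simp only [hz]; split_ifs <;> rfl
  by_contra hcon
  refine hmipe ⟨f z, (f z).2, fun s => ?_⟩
  by_cases hsp : s.1 = p.1
  · have : s = ⟨p.1, hp⟩ := Subtype.ext hsp
    subst this
    rw [hzv, hup]
    simp only [exp, eyp, hC]
  by_cases hsq : s.1 = q.1
  · have : s = ⟨q.1, hq⟩ := Subtype.ext hsq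
    subst this
    rw [hzv, huq]
    simp only [exq, eyq]
    revert hcon; generalize g q.1 _ = t; cases t <;> cases q.2 <;> simp
  · rw [hzv, ex' s hsq, ey' s hsp]
    simp only [ite_self]
    exact component_idem hX hf hi _ _

lemma TotallyBlocked.winning (hX : NonDegenerate X) (hT : TotallyBlocked X) {f : (Fin n → X) → X}
    {g : Fin m → (Fin n → Bool) → Bool} (hf : HasComponents f g) (hi : IsIdempotent f)
    (p q : Fin m × Bool) (C : Fin n → Bool)
    (hC : g p.1 (fun i => if C i then p.2 else !p.2) = p.2) :
    g q.1 (fun i => if C i then q.2 else !q.2) = q.2 := by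
  induction hT p q with
  | refl => exact hC
  | tail _ hbc ih => exact hbc.winning hX hf hi C ih

/-- Paths in both directions between `(k, 1)` and `(l, 1)` give the two issues the same winning
coalitions for 1. -/
lemma TotallyBlocked.component_eq (hX : NonDegenerate X) (hT : TotallyBlocked X)
    {f : (Fin n → X) → X} {g : Fin m → (Fin n → Bool) → Bool} (hf : HasComponents f g)
    (hi : IsIdempotent f) (k l : Fin m) : g k = g l := by
  funext u
  have h1 := hT.winning hX hf hi (k, true) (l, true) u
  have h2 := hT.winning hX hf hi (l, true) (k, true) u
  simp only [Bool.not_true, Bool.if_false_right, Bool.and_true, Bool.decide_eq_true] at h1 h2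
  exact Bool.eq_iff_iff.mpr ⟨h1, h2⟩

/-- Here the paths join `(k, 1)` and `(k, 0)`: a coalition can force 1 exactly when it can force 0.
-/
lemma TotallyBlocked.component_not (hX : NonDegenerate X) (hT : TotallyBlocked X)
    {f : (Fin n → X) → X} {g : Fin m → (Fin n → Bool) → Bool} (hf : HasComponents f g)
    (hi : IsIdempotent f) (k : Fin m) (u : Fin n → Bool) : g k (fun i => !u i) = !g k u := by
  have h1 := hT.winning hX hf hi (k, true) (k, false) u
  have h2 := hT.winning hX hf hi (k, false) (k, true) u
  have e1 : (fun i => if u i = true then true else !true) = u := by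
    funext i; cases u i <;> rfl
  have e2 : (fun i => if u i = true then false else !false) = fun i => !u i := by
    funext i; cases u i <;> rfl
  simp only [e1, e2] at h1 h2
  revert h1 h2; cases g k u <;> cases g k (fun i => !u i) <;> simp

/-- If `X` is closed under the coordinatewise majority operation, edges of the blockedness graph
are implications valid in `X`. -/
lemma BlockEdge.implies_of_majority {f : (Fin 3 → X) → X} {g : Fin m → (Fin 3 → Bool) → Bool}
    (hf : HasComponents f g)
    (hg : ∀ j u v w, g j ![u, v, w] = ((u || v) && (v || w) && (w || u)))
    {p q : Fin m × Bool} (hpq : BlockEdge X p q) {x : Fin m → Bool} (hx : x ∈ X)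
    (hxp : x p.1 = p.2) : x q.1 = q.2 := by
  obtain ⟨hne, S, hp, hq, u, hup, huq, hmipe, hflip⟩ := hpq
  obtain ⟨y, hy, ey⟩ := hflip ⟨q.1, hq⟩
  obtain ⟨z, hz, ez⟩ := hflip ⟨p.1, hp⟩
  by_contra hcon
  -- `y` and `z` each differ from `u` at one point of `S`, namely `q` and `p`. If `x` agrees with
  -- `u` at both, majority restores `u` on `S`.
  refine hmipe ⟨_, (f ![⟨x, hx⟩, ⟨y, hy⟩, ⟨z, hz⟩]).2, fun s => ?_⟩
  have e : (fun i => ((![⟨x, hx⟩, ⟨y, hy⟩, ⟨z, hz⟩] : Fin 3 → X) i : Fin m → Bool) s) =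
      ![x s, y s, z s] := by
    funext i; fin_cases i <;> rfl
  rw [hf, e, hg]
  by_cases hsp : s = ⟨p.1, hp⟩
  · have e1 : y s = u s := by
      rw [ey, Function.update_of_ne]
      rw [hsp]; exact fun h => hne (congrArg Subtype.val h)
    have e2 : x s = u s := by rw [hsp, hup]; exact hxp
    rw [e1, e2]; cases u s <;> simp
  by_cases hsq : s = ⟨q.1, hq⟩
  · have e1 : z s = u s := by rw [ez, Function.update_of_ne hsp]
    have e2 : x s = u s := by
      rw [hsq, huq]; revert hcon; simp only; cases x q.1 <;> cases q.2 <;> simp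
    rw [e1, e2]; cases u s <;> cases y s <;> simp
  · have e1 : z s = u s := by rw [ez, Function.update_of_ne hsp]
    have e2 : y s = u s := by rw [ey, Function.update_of_ne hsq]
    rw [e1, e2]; cases u s <;> cases x s <;> simp

lemma impossibilityDomain_of_totallyBlocked (hm : 1 ≤ m) (hX : NonDegenerate X)
    (hT : TotallyBlocked X) (hA : ¬ IsAffine X) : ImpossibilityDomain X := by
  rintro ⟨n, -, f, ⟨g, hf⟩, hi, hd⟩
  let j : Fin m := ⟨0, hm⟩
  rcases (components_isIdempotentClone hX j).classification with
    ⟨_, ⟨F, G, hF, hFi, rfl⟩, h⟩ | ⟨_, ⟨F, G, hF, hFi, rfl⟩, h⟩ | ⟨_, ⟨F, G, hF, hFi, rfl⟩, h⟩ | h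
  · have hn := hT.component_not hX hF hFi j ![true, false]
    have e : (fun i => !(![true, false] : Fin 2 → Bool) i) = ![false, true] := by
      funext i; fin_cases i <;> rfl
    rw [e] at hn
    rcases h with h | h <;> simp [h] at hn
  · have hG : ∀ l u v w, G l ![u, v, w] = ((u || v) && (v || w) && (w || u)) := fun l u v w => by
      rw [hT.component_eq hX hF hFi l j, h]
    obtain ⟨x, hx⟩ := hX.exists_mem j true
    have : ∀ q, Relation.ReflTransGen (BlockEdge X) (j, true) q → (x : Fin m → Bool) q.1 = q.2 := by
      intro q hq
      induction hq with
      | refl => exact hx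
      | tail _ hbc ih => exact hbc.implies_of_majority hF hG x.2 ih
    -- A path from `(j, 1)` to `(j, 0)` would force the 1 of `x` at `j` to be 0.
    have hfalse := this (j, false) (hT _ _)
    simp [hx] at hfalse
  · exact hA (isAffine_of_minority hF fun l u v w => by
      rw [hT.component_eq hX hF hFi l j, h])
  · obtain ⟨k, hk⟩ := h n (g j) ⟨f, g, hf, hi, rfl⟩
    exact hd ⟨k, fun x => Subtype.ext (funext fun l => by
      rw [hf, hT.component_eq hX hf hi l j, hk])⟩

end Evaluation

open Evaluation in
theorem mainTheorem4 {m : ℕ} (hm : 1 ≤ m) (X : Set (Fin m → Bool)) (hX : NonDegenerate X) :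
    (ImpossibilityDomain X ↔ TotallyBlocked X ∧ ¬ IsAffine X) ∧
    (¬ TotallyBlocked X → ∀ j : Fin m,
      (∃ (f : (Fin 2 → X) → X) (g : Fin m → (Fin 2 → Bool) → Bool),
        HasComponents f g ∧ IsIdempotent f ∧
          ((∀ u v : Bool, g j ![u, v] = (u || v)) ∨ (∀ u v : Bool, g j ![u, v] = (u && v)))) ∨
      (∃ (f : (Fin 3 → X) → X) (g : Fin m → (Fin 3 → Bool) → Bool),
        HasComponents f g ∧ IsIdempotent f ∧
          ∀ u v w : Bool, g j ![u, v, w] = ((u || v) && (v || w) && (w || u))) ∨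
      (∃ (f : (Fin 3 → X) → X) (g : Fin m → (Fin 3 → Bool) → Bool),
        HasComponents f g ∧ IsIdempotent f ∧
          ∀ u v w : Bool, toF2 (g j ![u, v, w]) = toF2 u - toF2 v + toF2 w) ∨
      (∀ (n : ℕ) (f : (Fin n → X) → X) (g : Fin m → (Fin n → Bool) → Bool),
        1 ≤ n → HasComponents f g → IsIdempotent f →
          ∃ k : Fin n, ∀ u : Fin n → Bool, g j u = u k)) := by
  refine ⟨⟨fun hI => ⟨?_, fun hA => hI (hA.possibilityDomain hm hX)⟩,
    fun h => impossibilityDomain_of_totallyBlocked hm hX h.1 h.2⟩, fun _ j => ?_⟩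
  · by_contra hT
    exact hI (possibilityDomain_of_not_totallyBlocked hX hT)
  · rcases (components_isIdempotentClone hX j).classification with
      ⟨_, ⟨f, g, hf, hi, rfl⟩, h⟩ | ⟨_, ⟨f, g, hf, hi, rfl⟩, h⟩ | ⟨_, ⟨f, g, hf, hi, rfl⟩, h⟩ | h
    · exact Or.inl ⟨f, g, hf, hi, h⟩
    · exact Or.inr (Or.inl ⟨f, g, hf, hi, h⟩)
    · exact Or.inr (Or.inr (Or.inl ⟨f, g, hf, hi, fun u v w => by rw [h, toF2_xor]⟩))
    · exact Or.inr (Or.inr (Or.inr fun n f g _ hf hi => h n (g j) ⟨f, g, hf, hi, rfl⟩))
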